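/- Setting. Let $\mathcal X$ and $\Omega$ be standard Borel spaces and $\mathcal Z$ a measurable space (for instance Borel subsets of Euclidean spaces), $\mathcal R:\mathcal X\to\mathcal Z$ a measurable representation, $c^*:\mathcal X\to\{0,1\}$ a measurable labelling function, and $\mathcal H$ a class of measurable hypotheses $\mathcal Z\to\{0,1\}$ of VC dimension $d<\infty$. For a probability measure $D$ on $\mathcal X$ write $\tilde D=\mathcal R_*D$ for its image under $\mathcal R$; for a predictor $g:\mathcal Z\to[0,1]$ let $\mathcal L_D(g)=\mathbb E_{x\sim D}|g(\mathcal R(x))-c^*(x)|$ be its risk, and for a data set $\hat S=(x_1,\dots,x_n)$ let $\hat{\mathcal L}_{\hat S}(g)=\frac1n\sum_i|g(\mathcal R(x_i))-c^*(x_i)|$ be its empirical risk. For probability measures $\mu,\nu$ on $\mathcal Z$ let $$d_{\mathcal H\Delta\mathcal H}(\mu,\nu)=2\sup_{h,h'\in\mathcal H}\bigl|\mu(\{h\ne h'\})-\nu(\{h\neq h'\})\bigr| .$$ Let $D$ be the global distribution, $D_1,\dots,D_K$ ($K\ge1$) the local distributions of the $K$ users and $D_A$ an augmented distribution, all on $\mathcal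 X$. Put $D_k'=\frac12(D_k+D_A)$ and $\lambda_k'=\inf_{h\in\mathcal H}\bigl(\mathcal L_{D_k'}(h)+\mathcal L_D(h)\bigr)$. Assume $d_{\mathcal H\Delta\mathcal H}(\tilde D_A,\tilde D)\le\varepsilon$. Let $1\le m<m'$ be integers (the number of samples per user before and after the augmentation) with $d\le 2m'$, and let $\delta\in(0,1]$. Let $$C(n)=\sqrt{\frac4n\Bigl(d\log\frac{2en}{d}+\log\frac{4K}{\delta}\Bigr)},$$ where the first summand is read as $0$ if $d=0$. Each user $k$ has a data set $\hat D_k'$ of $m'$ random points on a probability space over $\Omega$. The points of one data set are independent and their laws average to $D_k'$ (for example, they are i.i.d. from $D_k'$; or $m'=2m$, with $m$ points drawn from $D_k$ and $m$ from $D_A$); the data sets of different users may depend on each other. Each user learns a random hypothesis $h_k\in\mathcal H$, which may depend on all the data and on further randomness, such that $(\omega,z)\mapsto h_k(\omega)(z)$ is measurable. Let $h=\frac1K\sum_kh_k$. Then: 1. With probability at least $1-\delta$, $$\mathcal L_D(h)\le\frac1K\sum_{k=1}^K\hat{\mathcal L}_{\hat D_k'}(h_k)+\frac1K\sum_{k=1}^K\bigl(d_{\mathcal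 H\Delta\mathcal H}(\tilde D_k',\tilde D)+\lambda_k'\bigr)+C(m').$$ 2. The same bound holds, for all $h_1,\dots,h_K\in\mathcal H$ and with certainty, if the empirical risks $\hat{\mathcal L}_{\hat D_k'}(h_k)$ are replaced by the true risks $\mathcal L_{D_k'}(h_k)$. 3. For every $k$, $d_{\mathcal H\Delta\mathcal H}(\tilde D_k',\tilde D)\le\frac12d_{\mathcal H\Delta\mathcal H}(\tilde D_k,\tilde D)+\frac12d_{\mathcal H\Delta\mathcal H}(\tilde D_A,\tilde D)$. If $\varepsilon$ is so small that $\varepsilon\le d_{\mathcal H\Delta\mathcal H}(\tilde D_k,\tilde D)$, then $d_{\mathcal H\Delta\mathcal H}(\tilde D_k',\tilde D)\le d_{\mathcal H\Delta\mathcal H}(\tilde D_k,\tilde D)$. 4. If $d\le 2m$, then $C(m')<C(m)$. -/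

import Mathlib

open MeasureTheory ProbabilityTheory
open scoped ENNReal

namespace FedGen

/-- The label set `{0, 1}` is `Bool`; this is the numerical value of a label. -/
def labelValue (b : Bool) : ℝ := if b then 1 else 0

/-- A binary hypothesis regarded as a real-valued predictor. -/
def toPredictor {Z : Type*} (h : Z → Bool) : Z → ℝ := fun z => labelValue (h z)

/-- The global ensemble `(1/K) ∑ₖ hₖ`, a predictor with values in `[0, 1]`. -/
noncomputable def ensemble {Z : Type*} {K : ℕ} (h : Fin K → Z → Bool) : Z → ℝ :=
  fun z => (1 / (K : ℝ)) * ∑ k, toPredictor (h k) z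

/-- The risk of the predictor `g`, composed with the representation `R`, on the domain `⟨D, c⟩`,
for the loss `l(ŷ, y) = |ŷ - y|`. -/
noncomputable def risk {X Z : Type*} [MeasurableSpace X] (R : X → Z) (c : X → Bool)
    (D : Measure X) (g : Z → ℝ) : ℝ :=
  ∫ x, |g (R x) - labelValue (c x)| ∂D

/-- The empirical risk on the data set `x₁, …, xₙ`, labelled by `c`. -/
noncomputable def empiricalRisk {X Z : Type*} (R : X → Z) (c : X → Bool)
    {n : ℕ} (x : Fin n → X) (g : Z → ℝ) : ℝ :=
  (1 / (n : ℝ)) * ∑ i, |g (R (x i)) - labelValue (c (x i))|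

/-- The oracle performance `λ = min_{h ∈ H} (L_{⟨D₁, c⟩}(h) + L_{⟨D₂, c⟩}(h))`
(the infimum, which is the minimum whenever that exists). -/
noncomputable def oracleRisk {X Z : Type*} [MeasurableSpace X] (R : X → Z) (c : X → Bool)
    (H : Set (Z → Bool)) (D₁ D₂ : Measure X) : ℝ :=
  ⨅ h : H, (risk R c D₁ (toPredictor h.1) + risk R c D₂ (toPredictor h.1))

/-- The sets `{z | h z ⊕ h' z = 1}` on which two hypotheses of `H` disagree. -/
def disagreementSets {Z : Type*} (H : Set (Z → Bool)) : Set (Set Z) :=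
  {A | ∃ h ∈ H, ∃ h' ∈ H, A = {z | xor (h z) (h' z) = true}}

/-- The `HΔH`-divergence `2 sup_A |μ(A) - ν(A)|`, `A` ranging over the disagreement sets. -/
noncomputable def dHH {Z : Type*} [MeasurableSpace Z] (H : Set (Z → Bool))
    (μ ν : Measure Z) : ℝ :=
  2 * ⨆ A : disagreementSets H, |μ.real A.1 - ν.real A.1|

/-- `H` realizes every labelling of the finite set `s`. -/
def Shatters {Z : Type*} (H : Set (Z → Bool)) (s : Finset Z) : Prop :=
  ∀ f : Z → Bool, ∃ h ∈ H, ∀ z ∈ s, h z = f z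

/-- The Vapnik-Chervonenkis dimension: the supremum of the sizes of the shattered finite sets. -/
noncomputable def vcDim {Z : Type*} (H : Set (Z → Bool)) : ℕ∞ :=
  ⨆ s : {s : Finset Z // Shatters H s}, (s.1.card : ℕ∞)

/-- The even mixture `½ (μ + ν)` of two distributions. -/
noncomputable def mixture {X : Type*} [MeasurableSpace X] (μ ν : Measure X) : Measure X :=
  (2⁻¹ : ℝ≥0∞) • (μ + ν)

/-- `S` is a random data set of size `n` for the distribution `D`: its points are independent, and
their laws average to `D`. An i.i.d. sample of `D` is one; for `D = ½ (D₁ + D₂)`, so is the union of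
`n / 2` points drawn from `D₁` and `n / 2` points drawn from `D₂`. -/
structure IsDataset {Ω X : Type*} [MeasurableSpace Ω] [MeasurableSpace X] (P : Measure Ω)
    {n : ℕ} (S : Fin n → Ω → X) (D : Measure X) : Prop where
  measurable : ∀ i, Measurable (S i)
  indep : iIndepFun S P
  average_law : (n : ℝ≥0∞)⁻¹ • ∑ i, P.map (S i) = D

/-- The complexity term `√((4/n) (d log(2en/d) + log(4K/δ)))` for `n` samples
(for `d = 0` the summand `d log(2en/d)` is `0`). -/
noncomputable def complexityTerm (d K : ℕ) (δ : ℝ) (n : ℕ) : ℝ :=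
  Real.sqrt ((4 / (n : ℝ)) *
    ((d : ℝ) * Real.log (2 * Real.exp 1 * n / d) + Real.log (4 * K / δ)))

end FedGen

/-! Two independent arguments are combined. Domain adaptation: for every `g` in the class, the
triangle inequality for disagreement, used once under `D` and once under `D'`, compares the risks of
`h` on both domains at the cost of a change of measure on one disagreement set and of the two risks
of `g`; the infimum over `g` gives `risk_le_risk_add_dHH_add_oracleRisk`. Convexity of the loss then
passes to the ensemble.

Generalization: `measure_gap_le` is a Vapnik-Chervonenkis inequality for a single randomly chosen
hypothesis. Instead of a supremum over the class, whose measurability is unclear, it uses the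
conditional law of `ω` given the sample, a Markov kernel. A ghost sample replaces the true mean, and
members of each pair (sample point, ghost point) are exchanged by random signs. For a fixed double
sample only finitely many traces occur; Sauer-Shelah counts them and Hoeffding's inequality bounds
each. Exchanges act within one coordinate, so the points need independence but no common law. The
complexity term is chosen to make each user fail with probability at most `δ / K`; a union bound
allows dependence between users. -/

namespace FedGen

/-! ### Counting traces and signs -/

/-- The members of the family `F` restricted to the points `x i`. -/
def trace {X ι : Type*} (F : Set (X → Bool)) (x : ι → X) : Set (ι → Bool) :=
  (fun f i => f (x i)) '' F

/-- The Sauer-Shelah lemma for the traces of a class on a tuple of points. -/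
theorem ncard_trace_le_sum_choose {Z ι : Type*} [Fintype ι] (H : Set (Z → Bool)) (d : ℕ)
    (hd : vcDim H ≤ d) (z : ι → Z) :
    (trace H z).ncard ≤ ∑ k ∈ Finset.Iic d, (Fintype.card ι).choose k := by
  classical
  let toFin : (ι → Bool) → Finset ι := fun f => Finset.univ.filter fun i => f i = true
  have hinj : Function.Injective toFin := by
    intro f g hfg
    funext i
    have : i ∈ toFin f ↔ i ∈ toFin g := by rw [hfg]
    rw [Bool.eq_iff_iff]
    simpa [toFin] using this
  let A : Finset (Finset ι) := (trace H z).toFinite.toFinset.image toFin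
  have hA : (trace H z).ncard = A.card := by
    rw [Finset.card_image_of_injective _ hinj, Set.ncard_eq_toFinset_card]
  have memA : ∀ u, u ∈ A ↔ ∃ h ∈ H, toFin (fun i => h (z i)) = u := by
    intro u
    simp [A, trace]
  have hvc : A.vcDim ≤ d := by
    refine Finset.sup_le fun s hs => ?_
    rw [Finset.mem_shatterer] at hs
    -- Indices with the same point receive the same label, so no trace separates them; a shattered
    -- index set therefore maps injectively to points.
    have hzinj : Set.InjOn z s := by
      intro i hi j hj hij
      by_contra hne
      obtain ⟨u, hu, hsu⟩ := hs (t := {i}) (by simpa using hi)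
      obtain ⟨h, -, rfl⟩ := (memA u).1 hu
      have h1 : i ∈ s ∩ toFin (fun i => h (z i)) := by rw [hsu]; simp
      have h2 : j ∉ s ∩ toFin (fun i => h (z i)) := by
        rw [hsu]; simpa using fun e => hne e.symm
      have hj' : j ∈ s := hj
      simp [toFin, hj', ← hij] at h1 h2
      simp [h1.2] at h2
    have hsh : Shatters H (s.image z) := by
      intro f
      obtain ⟨u, hu, hsu⟩ := hs (t := s.filter fun i => f (z i) = true) (Finset.filter_subset _ _)
      obtain ⟨h, hh, rfl⟩ := (memA u).1 hu
      refine ⟨h, hh, fun y hy => ?_⟩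
      obtain ⟨i, hi, rfl⟩ := Finset.mem_image.1 hy
      have : i ∈ s ∩ toFin (fun i => h (z i)) ↔ i ∈ s.filter fun i => f (z i) = true := by
        rw [hsu]
      rw [Bool.eq_iff_iff]
      simpa [toFin, hi] using this
    have hle : (((s.image z).card : ℕ) : ℕ∞) ≤ vcDim H :=
      le_iSup (fun s : {s : Finset Z // Shatters H s} => (s.1.card : ℕ∞)) ⟨s.image z, hsh⟩
    rw [Finset.card_image_of_injOn hzinj] at hle
    exact_mod_cast hle.trans hd
  rw [hA]
  refine (A.card_le_card_shatterer.trans A.card_shatterer_le_sum_vcDim).trans ?_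
  exact Finset.sum_le_sum_of_subset (Finset.Iic_subset_Iic.2 hvc)

theorem sum_choose_le_exp (d N : ℕ) (hdN : d ≤ N) :
    ((∑ k ∈ Finset.Iic d, N.choose k : ℕ) : ℝ) ≤
      Real.exp (d * Real.log (Real.exp 1 * N / d)) := by
  rcases Nat.eq_zero_or_pos d with rfl | hd
  -- For `d = 0` both sides equal `1`, since the exponent has the factor `0`.
  · have : Finset.Iic 0 = ({0} : Finset ℕ) := by ext; simp
    simp [this]
  have hd' : (0 : ℝ) < d := by exact_mod_cast hd
  have hN : (0 : ℝ) < N := by exact_mod_cast hd.trans_le hdN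
  have hq : (d : ℝ) / N ≤ 1 := (div_le_one hN).2 (by exact_mod_cast hdN)
  have hq0 : 0 < (d : ℝ) / N := by positivity
  have hexp : Real.exp (d * Real.log (Real.exp 1 * N / d)) = (Real.exp 1 * N / d) ^ d := by
    rw [mul_comm, ← Real.rpow_def_of_pos (by positivity), Real.rpow_natCast]
  -- With `q = d / N ≤ 1`, each `k ≤ d` has `q ^ d ≤ q ^ k`; the binomial theorem and `(1 + q) ^ N ≤
  -- exp (q * N)` finish.
  have key : (∑ k ∈ Finset.Iic d, (N.choose k : ℝ)) * ((d : ℝ) / N) ^ d ≤ Real.exp d := by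
    calc (∑ k ∈ Finset.Iic d, (N.choose k : ℝ)) * ((d : ℝ) / N) ^ d
        ≤ ∑ k ∈ Finset.Iic d, ((d : ℝ) / N) ^ k * 1 ^ (N - k) * (N.choose k : ℝ) := by
          rw [Finset.sum_mul]
          refine Finset.sum_le_sum fun k hk => ?_
          rw [one_pow, mul_one, mul_comm]
          gcongr ?_ * _
          exact pow_le_pow_of_le_one hq0.le hq (Finset.mem_Iic.1 hk)
      _ ≤ ∑ k ∈ Finset.range (N + 1), ((d : ℝ) / N) ^ k * 1 ^ (N - k) * (N.choose k : ℝ) := by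
          refine Finset.sum_le_sum_of_subset_of_nonneg (fun k hk => ?_) fun k _ _ => by positivity
          have := Finset.mem_Iic.1 hk
          exact Finset.mem_range.2 (by omega)
      _ = ((d : ℝ) / N + 1) ^ N := (add_pow _ _ _).symm
      _ ≤ (Real.exp ((d : ℝ) / N)) ^ N := by gcongr; exact Real.add_one_le_exp _
      _ = Real.exp d := by
          rw [← Real.exp_nat_mul]; congr 1; field_simp
  rw [hexp, Nat.cast_sum]
  have : (Real.exp 1 * N / d) ^ d = Real.exp d / ((d : ℝ) / N) ^ d := by
    rw [← Real.exp_one_pow, ← div_pow]; congr 1; field_simp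
  rw [this, le_div_iff₀ (by positivity)]
  exact key

/-- The sign attached to a Boolean: `true` flips. -/
def flipSign (b : Bool) : ℝ := if b then -1 else 1

/-- Hoeffding's inequality for Rademacher sums, in counting form. -/
theorem card_signs_le {ι : Type*} [Fintype ι] [DecidableEq ι] (b : ι → ℝ) (hb : ∀ i, |b i| ≤ 1)
    (t : ℝ) (ht : 0 ≤ t) :
    ((Finset.univ.filter fun σ : ι → Bool =>
        Fintype.card ι * t ≤ ∑ i, flipSign (σ i) * b i).card : ℝ) ≤
      2 ^ Fintype.card ι * Real.exp (-(Fintype.card ι * t ^ 2 / 2)) := by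
  set n := Fintype.card ι
  have hsum : ∑ σ : ι → Bool, Real.exp (t * ∑ i, flipSign (σ i) * b i) ≤
      2 ^ n * Real.exp (n * t ^ 2 / 2) := by
    calc ∑ σ : ι → Bool, Real.exp (t * ∑ i, flipSign (σ i) * b i)
        = ∑ σ : ι → Bool, ∏ i, Real.exp (t * (flipSign (σ i) * b i)) := by
          refine Finset.sum_congr rfl fun σ _ => ?_
          rw [Finset.mul_sum, Real.exp_sum]
      _ = ∏ i, ∑ s : Bool, Real.exp (t * (flipSign s * b i)) :=
          (Fintype.prod_sum fun i s => Real.exp (t * (flipSign s * b i))).symm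
      _ = ∏ i, 2 * Real.cosh (t * b i) := by
          refine Finset.prod_congr rfl fun i _ => ?_
          rw [Real.cosh_eq]
          simp [flipSign]
          ring
      _ ≤ ∏ _i : ι, 2 * Real.exp (t ^ 2 / 2) := by
          refine Finset.prod_le_prod (fun i _ => by positivity) fun i _ => ?_
          refine mul_le_mul_of_nonneg_left ((Real.cosh_le_exp_half_sq _).trans ?_) (by norm_num)
          refine Real.exp_le_exp.2 (div_le_div_of_nonneg_right ?_ (by norm_num))
          rw [mul_pow]
          exact mul_le_of_le_one_right (sq_nonneg t) ((sq_le_one_iff_abs_le_one _).2 (hb i))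
      _ = 2 ^ n * Real.exp (n * t ^ 2 / 2) := by
          rw [Finset.prod_const, Finset.card_univ, mul_pow, ← Real.exp_nat_mul]
          congr 2
          ring
  -- Chernoff's bound with exponential parameter `t`, which minimizes `-n * s * t + n * s ^ 2 / 2`
  -- over `s`.
  have hcount : ((Finset.univ.filter fun σ : ι → Bool =>
        n * t ≤ ∑ i, flipSign (σ i) * b i).card : ℝ) * Real.exp (n * t ^ 2) ≤
      ∑ σ : ι → Bool, Real.exp (t * ∑ i, flipSign (σ i) * b i) := by
    rw [← nsmul_eq_mul, ← Finset.sum_const]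
    refine (Finset.sum_le_sum fun σ hσ => ?_).trans (Finset.sum_le_sum_of_subset_of_nonneg
      (Finset.filter_subset _ _) fun _ _ _ => (Real.exp_pos _).le)
    have := mul_le_mul_of_nonneg_left (Finset.mem_filter.1 hσ).2 ht
    refine Real.exp_le_exp.2 (le_of_eq_of_le ?_ this)
    ring
  refine le_of_mul_le_mul_right ((hcount.trans hsum).trans_eq ?_) (Real.exp_pos (n * t ^ 2))
  rw [mul_assoc, ← Real.exp_add]
  congr 2
  ring

/-- The number of sign patterns for which some member of a small family of pairs of
label vectors has a large signed difference. -/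
theorem card_exists_signs_le {ι : Type*} [Fintype ι] [DecidableEq ι]
    (T : Set (ι ⊕ ι → Bool)) (t : ℝ) (ht : 0 ≤ t) :
    (({σ : ι → Bool | ∃ p ∈ T, Fintype.card ι * t ≤
        ∑ i, flipSign (σ i) * (labelValue (p (.inr i)) - labelValue (p (.inl i)))}).ncard : ℝ) ≤
      T.ncard * (2 ^ Fintype.card ι * Real.exp (-(Fintype.card ι * t ^ 2 / 2))) := by
  classical
  let B : (ι ⊕ ι → Bool) → Finset (ι → Bool) := fun p => Finset.univ.filter fun σ =>
    Fintype.card ι * t ≤ ∑ i, flipSign (σ i) * (labelValue (p (.inr i)) - labelValue (p (.inl i)))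
  have hset : {σ : ι → Bool | ∃ p ∈ T, Fintype.card ι * t ≤
      ∑ i, flipSign (σ i) * (labelValue (p (.inr i)) - labelValue (p (.inl i)))} =
      (T.toFinite.toFinset.biUnion B : Finset (ι → Bool)) := by
    ext σ; simp [B]
  rw [hset, Set.ncard_coe_finset, Set.ncard_eq_toFinset_card T]
  calc ((T.toFinite.toFinset.biUnion B).card : ℝ)
      ≤ ∑ p ∈ T.toFinite.toFinset, ((B p).card : ℝ) := by exact_mod_cast Finset.card_biUnion_le
    _ ≤ ∑ _p ∈ T.toFinite.toFinset,
          2 ^ Fintype.card ι * Real.exp (-(Fintype.card ι * t ^ 2 / 2)) := by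
        refine Finset.sum_le_sum fun p _ => card_signs_le _ (fun i => ?_) t ht
        unfold labelValue
        split_ifs <;> norm_num
    _ = _ := by rw [Finset.sum_const, nsmul_eq_mul]

end FedGen

namespace FedGen

/-! ### Symmetrization -/

theorem measurable_labelValue : Measurable labelValue := measurable_of_finite _

theorem labelValue_nonneg (b : Bool) : 0 ≤ labelValue b := by
  unfold labelValue; split_ifs <;> norm_num

theorem labelValue_le_one (b : Bool) : labelValue b ≤ 1 := by
  unfold labelValue; split_ifs <;> norm_num

/-- Exchange the two members of the pairs selected by `σ`. -/
def exchange {X ι : Type*} (σ : ι → Bool) (x : (ι → X) × (ι → X)) : (ι → X) × (ι → X) :=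
  (fun i => if σ i then x.2 i else x.1 i, fun i => if σ i then x.1 i else x.2 i)

/-- Regrouped into pairs, the measure is a product of the squares `μ i × μ i`, each invariant under
the swap. The `μ i` may differ because no two indices are mixed. -/
theorem measurePreserving_exchange {X ι : Type*} [MeasurableSpace X] [Fintype ι]
    (μ : ι → Measure X) [∀ i, IsProbabilityMeasure (μ i)] (σ : ι → Bool) :
    MeasurePreserving (exchange σ) ((Measure.pi μ).prod (Measure.pi μ))
      ((Measure.pi μ).prod (Measure.pi μ)) := by
  have h1 := measurePreserving_arrowProdEquivProdArrow X X ι μ μ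
  have h2 : MeasurePreserving
      (fun (a : ι → X × X) i => (if σ i then Prod.swap else id : X × X → X × X) (a i))
      (Measure.pi fun i => (μ i).prod (μ i)) (Measure.pi fun i => (μ i).prod (μ i)) := by
    refine measurePreserving_pi _ _ fun i => ?_
    split_ifs
    · exact Measure.measurePreserving_swap
    · exact MeasurePreserving.id _
  have h3 := h1.comp (h2.comp h1.symm)
  convert h3 using 1
  funext x
  refine Prod.ext ?_ ?_ <;> funext i <;> by_cases h : σ i = true <;>
    simp [exchange, h, MeasurableEquiv.arrowProdEquivProdArrow, Equiv.arrowProdEquivProdArrow]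

/-- The sum of the differences of the losses on a ghost sample and on a sample. -/
def ghostGap {X ι : Type*} [Fintype ι] (f : X → Bool) (x : (ι → X) × (ι → X)) : ℝ :=
  ∑ i, (labelValue (f (x.2 i)) - labelValue (f (x.1 i)))

theorem ghostGap_exchange {X ι : Type*} [Fintype ι] (f : X → Bool) (σ : ι → Bool)
    (x : (ι → X) × (ι → X)) :
    ghostGap f (exchange σ x) =
      ∑ i, flipSign (σ i) * (labelValue (f (x.2 i)) - labelValue (f (x.1 i))) := by
  refine Finset.sum_congr rfl fun i _ => ?_
  by_cases h : σ i = true <;> simp [exchange, flipSign, h]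

theorem measurable_ghostGap {Ω X ι : Type*} [MeasurableSpace Ω] [MeasurableSpace X] [Fintype ι]
    {e : Ω → X → Bool} (he : Measurable fun p : Ω × X => e p.1 p.2) :
    Measurable fun q : ((ι → X) × (ι → X)) × Ω => ghostGap (e q.2) q.1 := by
  refine Finset.measurable_sum _ fun i _ => (measurable_labelValue.comp ?_).sub
    (measurable_labelValue.comp ?_)
  · exact he.comp (measurable_snd.prodMk ((measurable_pi_apply i).comp
      (measurable_snd.comp measurable_fst)))
  · exact he.comp (measurable_snd.prodMk ((measurable_pi_apply i).comp
      (measurable_fst.comp measurable_fst)))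

/-- For a kernel `κ` choosing a loss from the sample, exchanging sample and ghost sample bounds the
probability of a large gap, without measurability of the supremum over the class. -/
theorem lintegral_kernel_ghostGap_le {Ω X ι : Type*} [MeasurableSpace Ω] [MeasurableSpace X]
    [Fintype ι] [DecidableEq ι]
    (F : Set (X → Bool)) (N : ℕ) (hN : ∀ x : ι ⊕ ι → X, (trace F x).ncard ≤ N)
    {e : Ω → X → Bool} (heF : ∀ ω, e ω ∈ F) (he : Measurable fun p : Ω × X => e p.1 p.2)
    (μ : ι → Measure X) [∀ i, IsProbabilityMeasure (μ i)]
    (κ : Kernel (ι → X) Ω) [IsMarkovKernel κ] (t : ℝ) (ht : 0 ≤ t) :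
    ∫⁻ x, κ x.1 {ω | Fintype.card ι * t ≤ ghostGap (e ω) x}
        ∂((Measure.pi μ).prod (Measure.pi μ)) ≤
      ENNReal.ofReal (N * Real.exp (-(Fintype.card ι * t ^ 2 / 2))) := by
  set n := Fintype.card ι with hn
  set Q := (Measure.pi μ).prod (Measure.pi μ)
  let φ : (ι → X) × (ι → X) → ℝ≥0∞ := fun x => κ x.1 {ω | n * t ≤ ghostGap (e ω) x}
  have hφ : Measurable φ :=
    Kernel.measurable_kernel_prodMk_left (κ := κ.comap Prod.fst measurable_fst)
      (t := {q : ((ι → X) × (ι → X)) × Ω | n * t ≤ ghostGap (e q.2) q.1})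
      (measurableSet_le measurable_const (measurable_ghostGap he))
  have hpt : ∀ x, ∑ σ : ι → Bool, φ (exchange σ x) ≤
      ENNReal.ofReal (N * (2 ^ n * Real.exp (-(n * t ^ 2 / 2)))) := by
    intro x
    classical
    let z : ι ⊕ ι → X := Sum.elim x.1 x.2
    let B : Set (ι → Bool) := {σ | ∃ p ∈ trace F z, n * t ≤
        ∑ i, flipSign (σ i) * (labelValue (p (.inr i)) - labelValue (p (.inl i)))}
    -- The exchange also alters the sample that `κ` sees. This is harmless: outside `B` no member of
    -- `F` has a large gap, so the event is empty under any measure.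
    have hle : ∀ σ, φ (exchange σ x) ≤ if σ ∈ B then 1 else 0 := by
      intro σ
      split_ifs with hσ
      · exact prob_le_one
      · refine le_of_eq ?_
        have : {ω | n * t ≤ ghostGap (e ω) (exchange σ x)} = ∅ := by
          refine Set.eq_empty_of_forall_notMem fun ω hω => hσ ?_
          refine ⟨_, ⟨e ω, heF ω, rfl⟩, ?_⟩
          rw [Set.mem_ofPred_eq, ghostGap_exchange] at hω
          exact hω
        simp only [φ, this, measure_empty]
    calc ∑ σ, φ (exchange σ x) ≤ ∑ σ, if σ ∈ B then (1 : ℝ≥0∞) else 0 :=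
          Finset.sum_le_sum fun σ _ => hle σ
      _ = ENNReal.ofReal (B.ncard : ℝ) := by
          rw [Finset.sum_boole, ENNReal.ofReal_natCast, Set.ncard_eq_toFinset_card']
          congr 2
          ext σ
          simp
      _ ≤ _ := by
          refine ENNReal.ofReal_le_ofReal ((card_exists_signs_le (trace F z) t ht).trans ?_)
          gcongr
          exact hN z
  have hsum : (2 ^ n : ℝ≥0∞) * ∫⁻ x, φ x ∂Q ≤
      ENNReal.ofReal (N * (2 ^ n * Real.exp (-(n * t ^ 2 / 2)))) := by
    calc (2 ^ n : ℝ≥0∞) * ∫⁻ x, φ x ∂Q = ∑ _σ : ι → Bool, ∫⁻ x, φ x ∂Q := by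
          simp [hn]
      _ = ∑ σ : ι → Bool, ∫⁻ x, φ (exchange σ x) ∂Q := by
          refine Finset.sum_congr rfl fun σ _ => ?_
          exact ((measurePreserving_exchange μ σ).lintegral_comp hφ).symm
      _ = ∫⁻ x, ∑ σ : ι → Bool, φ (exchange σ x) ∂Q := by
          exact (lintegral_finsetSum _ fun σ _ =>
            hφ.comp (measurePreserving_exchange μ σ).measurable).symm
      _ ≤ ∫⁻ _x, ENNReal.ofReal (N * (2 ^ n * Real.exp (-(n * t ^ 2 / 2)))) ∂Q :=
          lintegral_mono hpt
      _ = _ := by simp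
  have h2 : ENNReal.ofReal (N * (2 ^ n * Real.exp (-(n * t ^ 2 / 2)))) =
      2 ^ n * ENNReal.ofReal (N * Real.exp (-(n * t ^ 2 / 2))) := by
    rw [mul_left_comm, ENNReal.ofReal_mul (by positivity), ENNReal.ofReal_pow (by norm_num)]
    simp
  rw [h2] at hsum
  exact (ENNReal.mul_le_mul_iff_right (by simp) (by simp)).1 hsum

/-- A ghost sample has, with probability at least `1/4`, empirical mean not much below the
mean. -/
theorem quarter_le_pi_ghost {X ι : Type*} [MeasurableSpace X] [Fintype ι]
    (μ : ι → Measure X) [∀ i, IsProbabilityMeasure (μ i)] (f : X → Bool) (hf : Measurable f)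
    (ε : ℝ) (hε : 0 < ε) (hnε : 16 / 3 ≤ Fintype.card ι * ε ^ 2) :
    1 / 4 ≤ Measure.pi μ {x | ∑ i, (∫ y, labelValue (f y) ∂(μ i)) - Fintype.card ι * (ε / 4) ≤
      ∑ i, labelValue (f (x i))} := by
  set n := Fintype.card ι
  have hn : (0 : ℝ) < n := by
    by_contra h
    nlinarith [sq_nonneg ε]
  have hmeas : Measurable fun y => labelValue (f y) := measurable_labelValue.comp hf
  have hmem : ∀ i, MemLp (fun y => labelValue (f y)) 2 (μ i) := fun i =>
    MemLp.of_bound hmeas.aestronglyMeasurable 1 (Filter.Eventually.of_forall fun y => by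
      rw [Real.norm_eq_abs, abs_of_nonneg (labelValue_nonneg _)]; exact labelValue_le_one _)
  let Y : (ι → X) → ℝ := ∑ i, fun x => labelValue (f (x i))
  have hY : ∀ x, Y x = ∑ i, labelValue (f (x i)) := fun x => Finset.sum_apply _ _ _
  have hmp : ∀ i, MemLp (fun x : ι → X => labelValue (f (x i))) 2 (Measure.pi μ) := fun i =>
    (hmem i).comp_measurePreserving (measurePreserving_eval μ i)
  have hYmem : MemLp Y 2 (Measure.pi μ) := memLp_finsetSum' _ fun i _ => hmp i
  have hmean : ∫ x, Y x ∂(Measure.pi μ) = ∑ i, ∫ y, labelValue (f y) ∂(μ i) := by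
    simp only [hY]
    rw [integral_finsetSum _ fun i _ => (hmp i).integrable (by norm_num)]
    refine Finset.sum_congr rfl fun i _ => ?_
    rw [← (measurePreserving_eval μ i).map_eq,
      integral_map (measurable_pi_apply i).aemeasurable hmeas.aestronglyMeasurable]
  have hvar : Var[Y; Measure.pi μ] ≤ n / 4 := by
    rw [variance_sum_pi hmem]
    calc ∑ i, Var[fun y => labelValue (f y); μ i] ≤ ∑ _i : ι, (1 / 4 : ℝ) := by
          refine Finset.sum_le_sum fun i _ => ?_
          refine (variance_le_sq_of_bounded (a := 0) (b := 1) (Filter.Eventually.of_forall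
            fun y => ⟨labelValue_nonneg _, labelValue_le_one _⟩) hmeas.aemeasurable).trans ?_
          norm_num
      _ = n / 4 := by simp [n]; ring
  have hcheb := meas_ge_le_variance_div_sq hYmem (c := n * (ε / 4)) (by positivity)
  -- The quotient is at most `4 / (n * ε ^ 2)`, which explains the threshold `16 / 3`.
  have h34 : ENNReal.ofReal (Var[Y; Measure.pi μ] / (n * (ε / 4)) ^ 2) ≤ ENNReal.ofReal (3 / 4) := by
    refine ENNReal.ofReal_le_ofReal ?_
    rw [div_le_iff₀ (by positivity)]
    nlinarith
  rw [hmean] at hcheb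
  set A := {x : ι → X | ∑ i, (∫ y, labelValue (f y) ∂(μ i)) - n * (ε / 4) ≤ ∑ i, labelValue (f (x i))}
  have hA : MeasurableSet A := measurableSet_le measurable_const
    (Finset.measurable_sum _ fun i _ => hmeas.comp (measurable_pi_apply i))
  have hAc : Measure.pi μ Aᶜ ≤ ENNReal.ofReal (3 / 4) := by
    refine (measure_mono fun x hx => ?_).trans (hcheb.trans h34)
    simp only [A, Set.mem_compl_iff, Set.mem_ofPred_eq, not_le] at hx
    simp only [Set.mem_ofPred_eq, hY]
    rw [abs_sub_comm]
    refine le_trans ?_ (le_abs_self _)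
    linarith
  have hreal : (Measure.pi μ).real Aᶜ ≤ 3 / 4 := ENNReal.toReal_le_of_le_ofReal (by norm_num) hAc
  rw [probReal_compl_eq_one_sub hA] at hreal
  have h4 : (1 / 4 : ℝ≥0∞) = ENNReal.ofReal (1 / 4) := by
    rw [ENNReal.ofReal_div_of_pos (by norm_num)]; simp
  rw [h4]
  refine ENNReal.ofReal_le_of_le_toReal ?_
  change 1 / 4 ≤ (Measure.pi μ).real A
  linarith

/-- The one-sided Vapnik-Chervonenkis inequality for a randomly chosen member of a class, on an
independent sample whose points need not have the same law. -/
theorem measure_gap_le {Ω X ι : Type*} [MeasurableSpace Ω] [StandardBorelSpace Ω]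
    [MeasurableSpace X] [Fintype ι] [DecidableEq ι]
    (P : Measure Ω) [IsProbabilityMeasure P]
    (S : ι → Ω → X) (hS : ∀ i, Measurable (S i)) (hindep : iIndepFun S P)
    (F : Set (X → Bool)) (N : ℕ) (hN : ∀ x : ι ⊕ ι → X, (trace F x).ncard ≤ N)
    {e : Ω → X → Bool} (heF : ∀ ω, e ω ∈ F) (he : Measurable fun p : Ω × X => e p.1 p.2)
    (ε : ℝ) (hε : 0 < ε) (hnε : 16 / 3 ≤ Fintype.card ι * ε ^ 2) :
    P {ω | ∑ i, labelValue (e ω (S i ω)) + Fintype.card ι * ε <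
        ∑ i, ∫ y, labelValue (e ω y) ∂(P.map (S i))} ≤
      ENNReal.ofReal (4 * N * Real.exp (-(Fintype.card ι * ε ^ 2 / 4))) := by
  set n := Fintype.card ι with hn
  set μ : ι → Measure X := fun i => P.map (S i) with hμ
  have : ∀ i, IsProbabilityMeasure (μ i) := fun i =>
    Measure.isProbabilityMeasure_map (hS i).aemeasurable
  have : Nonempty Ω := nonempty_of_isProbabilityMeasure P
  let Sv : Ω → ι → X := fun ω i => S i ω
  have hSv : Measurable Sv := measurable_pi_lambda _ hS
  have hlaw : P.map Sv = Measure.pi μ :=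
    (iIndepFun_iff_map_fun_eq_pi_map fun i => (hS i).aemeasurable).1 hindep
  have heω : ∀ ω, Measurable (e ω) := fun ω => he.comp measurable_prodMk_left
  -- What remains of `ε` once the ghost mean has lost `ε / 4`.
  set t : ℝ := 3 / 4 * ε with ht
  -- The law of all randomness given the sample; its existence rests on `Ω` being standard Borel.
  let κ := condDistrib (id : Ω → Ω) Sv P
  let G : Set (((ι → X) × (ι → X)) × Ω) := {q | n * t ≤ ghostGap (e q.2) q.1}
  have hG : MeasurableSet G := measurableSet_le measurable_const (measurable_ghostGap he)
  let G' : Set (Ω × (ι → X)) := {q | n * t ≤ ghostGap (e q.1) (Sv q.1, q.2)}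
  have hG' : MeasurableSet G' := hG.preimage
    (((hSv.comp measurable_fst).prodMk measurable_snd).prodMk measurable_fst)
  have hmean : Measurable fun ω => ∑ i, ∫ y, labelValue (e ω y) ∂(μ i) := by
    refine Finset.measurable_sum _ fun i _ => ?_
    exact ((measurable_labelValue.comp he).stronglyMeasurable.integral_prod_right').measurable
  set A : Set Ω := {ω | ∑ i, labelValue (e ω (S i ω)) + n * ε <
        ∑ i, ∫ y, labelValue (e ω y) ∂(μ i)} with hAdef
  have hA : MeasurableSet A := by
    refine measurableSet_lt (Measurable.add_const (Finset.measurable_sum _ fun i _ => ?_) _) hmean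
    exact measurable_labelValue.comp (he.comp (measurable_id.prodMk (hS i)))
  -- Once `ω` is fixed, `e ω` is a fixed function and the ghost sample is still independent of it,
  -- so Chebyshev applies.
  have hlower : P A * (1 / 4) ≤ (P.prod (Measure.pi μ)) G' := by
    rw [Measure.prod_apply hG', mul_comm, ← setLIntegral_const]
    refine (setLIntegral_mono (measurable_measure_prodMk_left hG') fun ω hω => ?_).trans
      (setLIntegral_le_lintegral _ _)
    refine (quarter_le_pi_ghost μ (e ω) (heω ω) ε hε hnε).trans (measure_mono fun x hx => ?_)
    simp only [hAdef, Set.mem_ofPred_eq] at hω hx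
    simp only [G', Set.mem_preimage, Set.mem_ofPred_eq, ghostGap, Finset.sum_sub_distrib, Sv]
    rw [ht]
    linarith
  -- For each fixed ghost sample `y`, the joint law of sample and `ω` is disintegrated along the
  -- sample.
  have hdis : (P.prod (Measure.pi μ)) G' =
      ∫⁻ x, κ x.1 {ω | n * t ≤ ghostGap (e ω) x} ∂((Measure.pi μ).prod (Measure.pi μ)) := by
    rw [Measure.prod_apply_symm hG', lintegral_prod_symm]
    · refine lintegral_congr fun y => ?_
      have hs : MeasurableSet {q : (ι → X) × Ω | n * t ≤ ghostGap (e q.2) (q.1, y)} :=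
        hG.preimage ((measurable_fst.prodMk measurable_const).prodMk measurable_snd)
      have hcomp : P.map Sv ⊗ₘ κ = P.map (fun ω => (Sv ω, id ω)) :=
        compProd_map_condDistrib measurable_id.aemeasurable
      have := congrArg (fun m => m {q : (ι → X) × Ω | n * t ≤ ghostGap (e q.2) (q.1, y)}) hcomp
      rw [Measure.compProd_apply hs, Measure.map_apply (hSv.prodMk measurable_id) hs, hlaw] at this
      exact this.symm
    · exact (Kernel.measurable_kernel_prodMk_left (κ := κ.comap Prod.fst measurable_fst)
        hG).aemeasurable
  have hupper := lintegral_kernel_ghostGap_le F N hN heF he μ κ t (by positivity)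
  rw [← hdis] at hupper
  have h4 : P A ≤ 4 * ENNReal.ofReal (N * Real.exp (-(n * t ^ 2 / 2))) := by
    have := mul_le_mul_right (hlower.trans hupper) 4
    refine le_trans (le_of_eq ?_) this
    rw [mul_left_comm, one_div, ENNReal.mul_inv_cancel (by norm_num) (by norm_num), mul_one]
  refine h4.trans ?_
  rw [mul_assoc, ENNReal.ofReal_mul (p := 4) (by norm_num)]
  refine mul_le_mul' (by simp) (ENNReal.ofReal_le_ofReal ?_)
  -- Here `t ^ 2 / 2 = 9 / 32 * ε ^ 2`, which is at least `ε ^ 2 / 4`.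
  refine mul_le_mul_of_nonneg_left (Real.exp_le_exp.2 ?_) (by positivity)
  have : 0 ≤ n * ε ^ 2 := by positivity
  rw [ht]
  nlinarith

end FedGen

namespace FedGen

/-! ### Divergence, domain adaptation and the complexity term -/

theorem isProbabilityMeasure_mixture {X : Type*} [MeasurableSpace X] (μ ν : Measure X)
    [IsProbabilityMeasure μ] [IsProbabilityMeasure ν] : IsProbabilityMeasure (mixture μ ν) := by
  refine ⟨?_⟩
  simp [mixture, ENNReal.inv_two_add_inv_two]

theorem mixture_real_apply {X : Type*} [MeasurableSpace X] (μ ν : Measure X)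
    [IsProbabilityMeasure μ] [IsProbabilityMeasure ν] (A : Set X) :
    (mixture μ ν).real A = (1 / 2) * (μ.real A + ν.real A) := by
  simp only [mixture, measureReal_ennreal_smul_apply]
  rw [measureReal_add_apply]
  simp

theorem map_mixture {X Z : Type*} [MeasurableSpace X] [MeasurableSpace Z] (μ ν : Measure X)
    {R : X → Z} (hR : Measurable R) :
    (mixture μ ν).map R = mixture (μ.map R) (ν.map R) := by
  simp only [mixture, Measure.map_smul, Measure.map_add _ _ hR]

theorem bddAbove_dHH {Z : Type*} [MeasurableSpace Z] (H : Set (Z → Bool)) (μ ν : Measure Z)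
    [IsProbabilityMeasure μ] [IsProbabilityMeasure ν] :
    BddAbove (Set.range fun A : disagreementSets H => |μ.real A.1 - ν.real A.1|) := by
  refine ⟨1, ?_⟩
  rintro _ ⟨A, rfl⟩
  have h1 : μ.real A.1 ≤ 1 := measureReal_le_one
  have h2 : ν.real A.1 ≤ 1 := measureReal_le_one
  have h3 : 0 ≤ μ.real A.1 := measureReal_nonneg
  have h4 : 0 ≤ ν.real A.1 := measureReal_nonneg
  exact abs_le.2 ⟨by linarith, by linarith⟩

theorem abs_sub_le_dHH {Z : Type*} [MeasurableSpace Z] {H : Set (Z → Bool)} (μ ν : Measure Z)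
    [IsProbabilityMeasure μ] [IsProbabilityMeasure ν] {A : Set Z} (hA : A ∈ disagreementSets H) :
    |μ.real A - ν.real A| ≤ (1 / 2) * dHH H μ ν := by
  have := le_ciSup (bddAbove_dHH H μ ν) ⟨A, hA⟩
  unfold dHH
  linarith

theorem dHH_nonneg {Z : Type*} [MeasurableSpace Z] (H : Set (Z → Bool)) (μ ν : Measure Z) :
    0 ≤ dHH H μ ν :=
  mul_nonneg (by norm_num) (Real.iSup_nonneg fun _ => abs_nonneg _)

theorem dHH_mixture_le {Z : Type*} [MeasurableSpace Z] (H : Set (Z → Bool)) (μ₁ μ₂ ν : Measure Z)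
    [IsProbabilityMeasure μ₁] [IsProbabilityMeasure μ₂] [IsProbabilityMeasure ν] :
    dHH H (mixture μ₁ μ₂) ν ≤ (1 / 2) * dHH H μ₁ ν + (1 / 2) * dHH H μ₂ ν := by
  have h1 := dHH_nonneg H μ₁ ν
  have h2 := dHH_nonneg H μ₂ ν
  suffices h : (⨆ A : disagreementSets H, |(mixture μ₁ μ₂).real A.1 - ν.real A.1|) ≤
      (1 / 4) * dHH H μ₁ ν + (1 / 4) * dHH H μ₂ ν by
    conv_lhs => unfold dHH
    linarith
  -- Nonnegativity of the bound covers empty `H`, where the supremum is `0` by convention.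
  refine Real.iSup_le (fun A => ?_) (by positivity)
  have e1 := abs_le.1 (abs_sub_le_dHH μ₁ ν A.2)
  have e2 := abs_le.1 (abs_sub_le_dHH μ₂ ν A.2)
  rw [mixture_real_apply]
  exact abs_le.2 ⟨by linarith [e1.1, e2.1], by linarith [e1.2, e2.2]⟩

theorem abs_labelValue_sub (a b : Bool) :
    |labelValue a - labelValue b| = labelValue (xor a b) := by
  cases a <;> cases b <;> simp [labelValue]

theorem integral_labelValue {X : Type*} [MeasurableSpace X] (μ : Measure X)
    {f : X → Bool} (hf : Measurable f) : ∫ x, labelValue (f x) ∂μ = μ.real {x | f x = true} := by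
  have hs : MeasurableSet {x | f x = true} := hf (measurableSet_singleton true)
  rw [← integral_indicator_one hs]
  refine integral_congr_ae (Filter.Eventually.of_forall fun x => ?_)
  by_cases h : f x = true <;> simp [labelValue, h]

theorem risk_toPredictor {X Z : Type*} [MeasurableSpace X] (R : X → Z) (c : X → Bool)
    (D : Measure X) (h : Z → Bool) :
    risk R c D (toPredictor h) = ∫ x, labelValue (xor (h (R x)) (c x)) ∂D := by
  simp only [risk, toPredictor, abs_labelValue_sub]

theorem measurable_xor {X : Type*} [MeasurableSpace X] {f g : X → Bool} (hf : Measurable f)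
    (hg : Measurable g) : Measurable fun x => xor (f x) (g x) :=
  (measurable_of_finite fun p : Bool × Bool => xor p.1 p.2).comp (hf.prodMk hg)

theorem risk_eq_measureReal {X Z : Type*} [MeasurableSpace X] [MeasurableSpace Z] {R : X → Z}
    (hR : Measurable R) {c : X → Bool} (hc : Measurable c) (D : Measure X) {h : Z → Bool}
    (hh : Measurable h) :
    risk R c D (toPredictor h) = D.real {x | xor (h (R x)) (c x) = true} := by
  rw [risk_toPredictor]
  exact integral_labelValue D (measurable_xor (hh.comp hR) hc)

/-- The domain adaptation bound. -/
theorem risk_le_risk_add_dHH_add_oracleRisk {X Z : Type*} [MeasurableSpace X] [MeasurableSpace Z]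
    {R : X → Z} (hR : Measurable R) {c : X → Bool} (hc : Measurable c) {H : Set (Z → Bool)}
    (hH : ∀ h ∈ H, Measurable h) (D' D : Measure X) [IsProbabilityMeasure D']
    [IsProbabilityMeasure D] {h : Z → Bool} (hh : h ∈ H) :
    risk R c D (toPredictor h) ≤
      risk R c D' (toPredictor h) + (dHH H (D'.map R) (D.map R) + oracleRisk R c H D' D) := by
  have : IsProbabilityMeasure (D'.map R) := Measure.isProbabilityMeasure_map hR.aemeasurable
  have : IsProbabilityMeasure (D.map R) := Measure.isProbabilityMeasure_map hR.aemeasurable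
  have : Nonempty H := ⟨⟨h, hh⟩⟩
  have hdiv := dHH_nonneg H (D'.map R) (D.map R)
  -- Isolating the infimum reduces the claim to one competitor `g`. The change of measure costs only
  -- half the divergence; the other half is slack.
  suffices hs : risk R c D (toPredictor h) - risk R c D' (toPredictor h) -
      dHH H (D'.map R) (D.map R) ≤ oracleRisk R c H D' D by linarith
  refine le_ciInf fun ⟨g, hg⟩ => ?_
  have hhm := hH h hh
  have hgm := hH g hg
  simp only [risk_eq_measureReal hR hc _ hhm, risk_eq_measureReal hR hc _ hgm]
  have hA : MeasurableSet {z | xor (h z) (g z) = true} :=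
    measurable_xor hhm hgm (measurableSet_singleton true)
  have h1 := (abs_le.1 (abs_sub_le_dHH (D'.map R) (D.map R)
    (A := {z | xor (h z) (g z) = true}) ⟨h, hh, g, hg, rfl⟩)).1
  rw [map_measureReal_apply hR hA, map_measureReal_apply hR hA] at h1
  have h2 : D.real {x | xor (h (R x)) (c x) = true} ≤
      D.real (R ⁻¹' {z | xor (h z) (g z) = true}) + D.real {x | xor (g (R x)) (c x) = true} := by
    refine (measureReal_mono fun x hx => ?_).trans (measureReal_union_le _ _)
    simp only [Set.mem_union, Set.mem_preimage, Set.mem_ofPred_eq] at hx ⊢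
    revert hx
    cases h (R x) <;> cases g (R x) <;> cases c x <;> simp
  have h3 : D'.real (R ⁻¹' {z | xor (h z) (g z) = true}) ≤
      D'.real {x | xor (h (R x)) (c x) = true} + D'.real {x | xor (g (R x)) (c x) = true} := by
    refine (measureReal_mono fun x hx => ?_).trans (measureReal_union_le _ _)
    simp only [Set.mem_union, Set.mem_preimage, Set.mem_ofPred_eq] at hx ⊢
    revert hx
    cases h (R x) <;> cases g (R x) <;> cases c x <;> simp
  linarith

/-- Convexity of the absolute value: the label is the mean of `K` copies of itself. -/
theorem risk_ensemble_le {X Z : Type*} [MeasurableSpace X] [MeasurableSpace Z]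
    {R : X → Z} (hR : Measurable R) {c : X → Bool} (hc : Measurable c) {K : ℕ} (hK : 0 < K)
    (D : Measure X) [IsProbabilityMeasure D] (g : Fin K → Z → Bool) (hg : ∀ k, Measurable (g k)) :
    risk R c D (ensemble g) ≤ (1 / (K : ℝ)) * ∑ k, risk R c D (toPredictor (g k)) := by
  have hK' : (0 : ℝ) < K := by exact_mod_cast hK
  have hlv : Measurable labelValue := measurable_of_finite _
  have hint : ∀ k, Integrable (fun x => |toPredictor (g k) (R x) - labelValue (c x)|) D := by
    intro k
    refine Integrable.of_bound (C := 1) ?_ (Filter.Eventually.of_forall fun x => ?_)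
    · exact (((hlv.comp ((hg k).comp hR)).sub (hlv.comp hc)).abs).aestronglyMeasurable
    · rw [Real.norm_eq_abs, abs_abs, toPredictor]
      unfold labelValue
      split_ifs <;> norm_num
  unfold risk
  rw [← integral_finsetSum _ fun k _ => hint k, ← integral_const_mul]
  refine integral_mono_of_nonneg (Filter.Eventually.of_forall fun x => abs_nonneg _)
    ((integrable_finsetSum _ fun k _ => hint k).const_mul _)
    (Filter.Eventually.of_forall fun x => ?_)
  have hsplit : ensemble g (R x) - labelValue (c x) =
      (1 / (K : ℝ)) * ∑ k, (toPredictor (g k) (R x) - labelValue (c x)) := by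
    rw [ensemble, Finset.sum_sub_distrib, mul_sub]
    simp [hK'.ne']
  simp only [hsplit, abs_mul, abs_of_pos (one_div_pos.2 hK')]
  exact mul_le_mul_of_nonneg_left (Finset.abs_sum_le_sum_abs _ _) (by positivity)

theorem risk_ensemble_le_risk_add {X Z : Type*} [MeasurableSpace X] [MeasurableSpace Z]
    {R : X → Z} (hR : Measurable R) {c : X → Bool} (hc : Measurable c) {H : Set (Z → Bool)}
    (hH : ∀ h ∈ H, Measurable h) {K : ℕ} (hK : 0 < K) (D : Measure X) [IsProbabilityMeasure D]
    (D' : Fin K → Measure X) [∀ k, IsProbabilityMeasure (D' k)]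
    (g : Fin K → Z → Bool) (hg : ∀ k, g k ∈ H) :
    risk R c D (ensemble g) ≤
      (1 / (K : ℝ)) * ∑ k, risk R c (D' k) (toPredictor (g k)) +
      (1 / (K : ℝ)) * ∑ k, (dHH H ((D' k).map R) (D.map R) + oracleRisk R c H (D' k) D) := by
  refine (risk_ensemble_le hR hc hK D g fun k => hH _ (hg k)).trans ?_
  rw [← mul_add, ← Finset.sum_add_distrib]
  refine mul_le_mul_of_nonneg_left (Finset.sum_le_sum fun k _ => ?_) (by positivity)
  exact risk_le_risk_add_dHH_add_oracleRisk hR hc hH (D' k) D (hg k)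

theorem log_four_le_log_four_mul_div {K : ℕ} (hK : 0 < K) {δ : ℝ} (hδ0 : 0 < δ) (hδ1 : δ ≤ 1) :
    Real.log 4 ≤ Real.log (4 * K / δ) := by
  have : (1 : ℝ) ≤ K := by exact_mod_cast hK
  refine Real.log_le_log (by norm_num) ?_
  rw [le_div_iff₀ hδ0]
  nlinarith

/-- Ensures `n * C ^ 2 ≥ 4 * log 4 ≥ 16 / 3`, the sample size that the Chebyshev step requires. -/
theorem four_thirds_le_log_four : 4 / 3 ≤ Real.log 4 := by
  have : Real.log 4 = 2 * Real.log 2 := by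
    rw [← Real.log_rpow (by norm_num)]; norm_num
  linarith [Real.log_two_gt_d9]

theorem exp_one_le_of_le_two_mul {d n : ℕ} (hd : 0 < d) (hdn : d ≤ 2 * n) :
    Real.exp 1 ≤ 2 * Real.exp 1 * n / d := by
  have h1 : (0 : ℝ) < d := by exact_mod_cast hd
  have h2 : (d : ℝ) ≤ 2 * n := by exact_mod_cast hdn
  rw [le_div_iff₀ h1]
  nlinarith [Real.exp_pos 1]

theorem mul_log_nonneg {d n : ℕ} (hdn : d ≤ 2 * n) :
    0 ≤ (d : ℝ) * Real.log (2 * Real.exp 1 * n / d) := by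
  rcases Nat.eq_zero_or_pos d with rfl | hd
  · simp
  · have := exp_one_le_of_le_two_mul hd hdn
    have h1 : (1 : ℝ) ≤ Real.exp 1 := Real.one_le_exp (by norm_num)
    exact mul_nonneg (by positivity) (Real.log_nonneg (h1.trans this))

/-- Strictness comes from the confidence term. The dimension term is a multiple of `log x / x` at `x
= 2en/d`, which decreases only from `e` on; hence the condition `d ≤ 2 * m`. -/
theorem complexityTerm_lt {d K : ℕ} (hK : 0 < K) {δ : ℝ} (hδ0 : 0 < δ) (hδ1 : δ ≤ 1) {m m' : ℕ}
    (hm : 0 < m) (hmm' : m < m') (hdm : d ≤ 2 * m) :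
    complexityTerm d K δ m' < complexityTerm d K δ m := by
  have hm0 : (0 : ℝ) < m := by exact_mod_cast hm
  have hlt : (m : ℝ) < m' := by exact_mod_cast hmm'
  have hm0' : (0 : ℝ) < m' := hm0.trans hlt
  have hL : 0 < Real.log (4 * K / δ) :=
    lt_of_lt_of_le (by linarith [four_thirds_le_log_four]) (log_four_le_log_four_mul_div hK hδ0 hδ1)
  have hdm' : d ≤ 2 * m' := by omega
  refine Real.sqrt_lt_sqrt
    (mul_nonneg (by positivity) (add_nonneg (mul_log_nonneg hdm') hL.le)) ?_
  have h1 : (4 / (m' : ℝ)) * Real.log (4 * K / δ) < (4 / (m : ℝ)) * Real.log (4 * K / δ) := by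
    gcongr
  have h2 : (4 / (m' : ℝ)) * (d * Real.log (2 * Real.exp 1 * m' / d)) ≤
      (4 / (m : ℝ)) * (d * Real.log (2 * Real.exp 1 * m / d)) := by
    rcases Nat.eq_zero_or_pos d with rfl | hd
    · simp
    have hd0 : (0 : ℝ) < d := by exact_mod_cast hd
    have key := Real.log_div_self_antitoneOn (exp_one_le_of_le_two_mul hd hdm)
      (exp_one_le_of_le_two_mul hd hdm') (by gcongr)
    simp only at key
    have e : ∀ x : ℝ, 0 < x → (4 / x) * (d * Real.log (2 * Real.exp 1 * x / d)) =
        8 * Real.exp 1 * (Real.log (2 * Real.exp 1 * x / d) / (2 * Real.exp 1 * x / d)) := by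
      intro x hx
      field_simp
      ring
    rw [e _ hm0', e _ hm0]
    exact mul_le_mul_of_nonneg_left key (by positivity)
  rw [mul_add, mul_add]
  linarith

end FedGen

namespace FedGen

/-! ### The generalization bound -/

/-- The loss class of the hypotheses `H` composed with the representation `R`. -/
def lossClass {X Z : Type*} (R : X → Z) (c : X → Bool) (H : Set (Z → Bool)) : Set (X → Bool) :=
  (fun h x => xor (h (R x)) (c x)) '' H

/-- On fixed points the labels are fixed, so the loss trace is a function of the hypothesis trace.
-/
theorem ncard_trace_lossClass_le {X Z ι : Type*} [Finite ι] (R : X → Z) (c : X → Bool)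
    (H : Set (Z → Bool)) (x : ι → X) :
    (trace (lossClass R c H) x).ncard ≤ (trace H fun i => R (x i)).ncard := by
  have : trace (lossClass R c H) x =
      (fun (p : ι → Bool) i => xor (p i) (c (x i))) '' trace H fun i => R (x i) := by
    simp only [trace, lossClass, Set.image_image]
  rw [this]
  exact Set.ncard_image_le (Set.toFinite _)

theorem complexityTerm_sq {d K n : ℕ} (hK : 0 < K) (hn : 0 < n) {δ : ℝ} (hδ0 : 0 < δ)
    (hδ1 : δ ≤ 1) (hdn : d ≤ 2 * n) :
    n * complexityTerm d K δ n ^ 2 =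
      4 * (d * Real.log (2 * Real.exp 1 * n / d) + Real.log (4 * K / δ)) := by
  have hn' : (0 : ℝ) < n := by exact_mod_cast hn
  have h1 := mul_log_nonneg hdn
  have h2 := log_four_le_log_four_mul_div hK hδ0 hδ1
  have h3 := four_thirds_le_log_four
  rw [complexityTerm, Real.sq_sqrt (mul_nonneg (by positivity) (by linarith))]
  field_simp

/-- Risk is linear in the distribution, so only the average of the laws of the points matters. -/
theorem IsDataset.risk_eq {Ω X Z : Type*} [MeasurableSpace Ω] [MeasurableSpace X]
    [MeasurableSpace Z] {P : Measure Ω} [IsProbabilityMeasure P] {n : ℕ} {S : Fin n → Ω → X}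
    {D : Measure X} (hS : IsDataset P S D) {R : X → Z} (hR : Measurable R) {c : X → Bool}
    (hc : Measurable c) {g : Z → Bool} (hg : Measurable g) :
    risk R c D (toPredictor g) =
      (1 / (n : ℝ)) * ∑ i, ∫ x, labelValue (xor (g (R x)) (c x)) ∂(P.map (S i)) := by
  have hm : Measurable fun x => labelValue (xor (g (R x)) (c x)) :=
    measurable_labelValue.comp (measurable_xor (hg.comp hR) hc)
  rw [risk_toPredictor, ← hS.average_law, integral_smul_measure, integral_finsetSum_measure]
  · simp
  · intro i _
    have := Measure.isProbabilityMeasure_map (μ := P) (hS.measurable i).aemeasurable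
    refine Integrable.of_bound (C := 1) hm.aestronglyMeasurable
      (Filter.Eventually.of_forall fun x => ?_)
    rw [Real.norm_eq_abs, abs_of_nonneg (labelValue_nonneg _)]
    exact labelValue_le_one _

theorem empiricalRisk_toPredictor {X Z : Type*} (R : X → Z) (c : X → Bool) {n : ℕ}
    (x : Fin n → X) (g : Z → Bool) :
    empiricalRisk R c x (toPredictor g) =
      (1 / (n : ℝ)) * ∑ i, labelValue (xor (g (R (x i))) (c (x i))) := by
  simp only [empiricalRisk, toPredictor, abs_labelValue_sub]

/-- The generalization bound of a single user. -/
theorem IsDataset.measure_empiricalRisk_add_lt_risk_le {Ω X Z : Type*} [MeasurableSpace Ω]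
    [StandardBorelSpace Ω] [MeasurableSpace X] [MeasurableSpace Z] {P : Measure Ω}
    [IsProbabilityMeasure P] {n : ℕ} (hn : 0 < n) {S : Fin n → Ω → X} {D : Measure X}
    (hS : IsDataset P S D) {R : X → Z} (hR : Measurable R) {c : X → Bool} (hc : Measurable c)
    {H : Set (Z → Bool)} (hH : ∀ h ∈ H, Measurable h) {d : ℕ} (hd : vcDim H ≤ d)
    (hdn : d ≤ 2 * n) {K : ℕ} (hK : 0 < K) {δ : ℝ} (hδ0 : 0 < δ) (hδ1 : δ ≤ 1)
    {h : Ω → Z → Bool} (hhH : ∀ ω, h ω ∈ H) (hhm : Measurable fun p : Ω × Z => h p.1 p.2) :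
    P {ω | empiricalRisk R c (fun i => S i ω) (toPredictor (h ω)) + complexityTerm d K δ n <
      risk R c D (toPredictor (h ω))} ≤ ENNReal.ofReal (δ / K) := by
  have hn' : (0 : ℝ) < n := by exact_mod_cast hn
  have hK' : (0 : ℝ) < K := by exact_mod_cast hK
  set C := complexityTerm d K δ n with hC
  have hCsq := complexityTerm_sq hK hn hδ0 hδ1 hdn
  rw [← hC] at hCsq
  have hlog := mul_log_nonneg hdn
  have hL := log_four_le_log_four_mul_div hK hδ0 hδ1
  have h43 := four_thirds_le_log_four
  have hC0 : 0 < C := by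
    refine lt_of_le_of_ne (Real.sqrt_nonneg _) fun h0 => ?_
    rw [← h0] at hCsq
    linarith
  -- Sample and ghost sample together have `2 * n` points, the source of `2en/d`.
  set N := ∑ k ∈ Finset.Iic d, (Fintype.card (Fin n ⊕ Fin n)).choose k with hNdef
  have hN : ∀ x : Fin n ⊕ Fin n → X, (trace (lossClass R c H) x).ncard ≤ N := fun x =>
    (ncard_trace_lossClass_le R c H x).trans (ncard_trace_le_sum_choose H d hd _)
  have hNle : (N : ℝ) ≤ Real.exp (d * Real.log (2 * Real.exp 1 * n / d)) := by
    have hcard : Fintype.card (Fin n ⊕ Fin n) = 2 * n := by simp [two_mul]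
    refine (sum_choose_le_exp d _ (hcard ▸ hdn)).trans (le_of_eq ?_)
    rw [hcard]
    push_cast
    congr 4
    ring
  let e : Ω → X → Bool := fun ω x => xor (h ω (R x)) (c x)
  have he : Measurable fun p : Ω × X => e p.1 p.2 :=
    measurable_xor (hhm.comp (measurable_fst.prodMk (hR.comp measurable_snd)))
      (hc.comp measurable_snd)
  have hmain := measure_gap_le P S hS.measurable hS.indep (lossClass R c H) N hN
    (e := e) (fun ω => ⟨h ω, hhH ω, rfl⟩) he C hC0 (by
      rw [Fintype.card_fin, hCsq]; linarith)
  rw [Fintype.card_fin] at hmain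
  refine (measure_mono fun ω hω => ?_).trans (hmain.trans (ENNReal.ofReal_le_ofReal ?_))
  · simp only [Set.mem_ofPred_eq] at hω ⊢
    rw [empiricalRisk_toPredictor, hS.risk_eq hR hc (hH _ (hhH ω))] at hω
    have := mul_lt_mul_of_pos_left hω hn'
    rw [mul_add, ← mul_assoc, ← mul_assoc, mul_one_div_cancel hn'.ne', one_mul, one_mul] at this
    exact this
  -- The first factor cancels the bound on `N`, and the `4` in `4 * K / δ` cancels the prefactor of
  -- `measure_gap_le`.
  · have hexp : Real.exp (-(n * C ^ 2 / 4)) =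
        (Real.exp (d * Real.log (2 * Real.exp 1 * n / d)))⁻¹ * (δ / (4 * K)) := by
      rw [hCsq, mul_div_cancel_left₀ _ (by norm_num), neg_add, Real.exp_add, Real.exp_neg,
        Real.exp_neg (Real.log _), Real.exp_log (by positivity), inv_div]
    rw [hexp]
    calc 4 * (N : ℝ) * ((Real.exp (d * Real.log (2 * Real.exp 1 * n / d)))⁻¹ * (δ / (4 * K)))
        ≤ 4 * Real.exp (d * Real.log (2 * Real.exp 1 * n / d)) *
          ((Real.exp (d * Real.log (2 * Real.exp 1 * n / d)))⁻¹ * (δ / (4 * K))) := by gcongr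
      _ = δ / K := by
          have := (Real.exp_pos (d * Real.log (2 * Real.exp 1 * n / d))).ne'
          field_simp

end FedGen

theorem corollary1
    {X Z Ω : Type*} [MeasurableSpace X] [StandardBorelSpace X] [MeasurableSpace Z]
    [MeasurableSpace Ω] [StandardBorelSpace Ω]
    -- the users, the labelling function, the shared representation, the hypothesis class
    (K : ℕ) (hK : 0 < K)
    (c : X → Bool) (hc : Measurable c)
    (R : X → Z) (hR : Measurable R)
    (H : Set (Z → Bool)) (hH : ∀ h ∈ H, Measurable h)
    (d : ℕ) (hd : FedGen.vcDim H = d)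
    -- the global, the local and the augmented distribution
    (D : Measure X) [IsProbabilityMeasure D]
    (Dloc : Fin K → Measure X) [∀ k, IsProbabilityMeasure (Dloc k)]
    (DA : Measure X) [IsProbabilityMeasure DA]
    (ε : ℝ) (hε : FedGen.dHH H (DA.map R) (D.map R) ≤ ε)
    (δ : ℝ) (hδ0 : 0 < δ) (hδ1 : δ ≤ 1)
    -- the sample sizes before and after the augmentation
    (m m' : ℕ) (hm : 0 < m) (hmm' : m < m') (hdm' : d ≤ 2 * m')
    -- the augmented data sets of the users and the hypotheses learned by them
    (P : Measure Ω) [IsProbabilityMeasure P]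
    (S : Fin K → Fin m' → Ω → X)
    (hS : ∀ k, FedGen.IsDataset P (S k) (FedGen.mixture (Dloc k) DA))
    (h : Fin K → Ω → Z → Bool) (hhH : ∀ k ω, h k ω ∈ H)
    (hhm : ∀ k, Measurable (fun p : Ω × Z => h k p.1 p.2)) :
    -- the generalization bound, with the empirical risks on the augmented data sets
    (1 - δ ≤ P.real {ω |
      FedGen.risk R c D (FedGen.ensemble (fun k => h k ω)) ≤
        (1 / (K : ℝ)) * ∑ k, FedGen.empiricalRisk R c (fun i => S k i ω)
            (FedGen.toPredictor (h k ω))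
        + (1 / (K : ℝ)) * ∑ k,
            (FedGen.dHH H ((FedGen.mixture (Dloc k) DA).map R) (D.map R)
              + FedGen.oracleRisk R c H (FedGen.mixture (Dloc k) DA) D)
        + FedGen.complexityTerm d K δ m'}) ∧
    -- the same bound with the true risks on the augmented domains, for all hypotheses
    (∀ g : Fin K → Z → Bool, (∀ k, g k ∈ H) →
      FedGen.risk R c D (FedGen.ensemble g) ≤
        (1 / (K : ℝ)) * ∑ k, FedGen.risk R c (FedGen.mixture (Dloc k) DA)
            (FedGen.toPredictor (g k))
        + (1 / (K : ℝ)) * ∑ k,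
            (FedGen.dHH H ((FedGen.mixture (Dloc k) DA).map R) (D.map R)
              + FedGen.oracleRisk R c H (FedGen.mixture (Dloc k) DA) D)
        + FedGen.complexityTerm d K δ m') ∧
    -- the divergence after the augmentation
    (∀ k, FedGen.dHH H ((FedGen.mixture (Dloc k) DA).map R) (D.map R) ≤
      (1 / 2) * FedGen.dHH H ((Dloc k).map R) (D.map R)
        + (1 / 2) * FedGen.dHH H (DA.map R) (D.map R)) ∧
    (∀ k, ε ≤ FedGen.dHH H ((Dloc k).map R) (D.map R) →
      FedGen.dHH H ((FedGen.mixture (Dloc k) DA).map R) (D.map R) ≤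
        FedGen.dHH H ((Dloc k).map R) (D.map R)) ∧
    -- the complexity term strictly decreases
    (d ≤ 2 * m → FedGen.complexityTerm d K δ m' < FedGen.complexityTerm d K δ m) := by
  have hm' : 0 < m' := hm.trans hmm'
  have hprob : ∀ k, IsProbabilityMeasure (FedGen.mixture (Dloc k) DA) := fun k =>
    FedGen.isProbabilityMeasure_mixture _ _
  have hadapt := fun g hg => FedGen.risk_ensemble_le_risk_add hR hc hH hK D
    (fun k => FedGen.mixture (Dloc k) DA) g hg
  have hC : 0 ≤ FedGen.complexityTerm d K δ m' := Real.sqrt_nonneg _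
  have hdiv : ∀ k, FedGen.dHH H ((FedGen.mixture (Dloc k) DA).map R) (D.map R) ≤
      (1 / 2) * FedGen.dHH H ((Dloc k).map R) (D.map R)
        + (1 / 2) * FedGen.dHH H (DA.map R) (D.map R) := by
    intro k
    have := Measure.isProbabilityMeasure_map (μ := Dloc k) hR.aemeasurable
    have := Measure.isProbabilityMeasure_map (μ := DA) hR.aemeasurable
    have := Measure.isProbabilityMeasure_map (μ := D) hR.aemeasurable
    rw [FedGen.map_mixture _ _ hR]
    exact FedGen.dHH_mixture_le H _ _ _
  -- With true risks the bound holds without the complexity term, which is added as nonnegative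
  -- slack.
  refine ⟨?_, fun g hg => (hadapt g hg).trans (le_add_of_nonneg_right hC), hdiv,
    fun k hk => by linarith [hdiv k], fun hdm => FedGen.complexityTerm_lt hK hδ0 hδ1 hm hmm' hdm⟩
  have hK' : (0 : ℝ) < K := by exact_mod_cast hK
  let bad : Fin K → Set Ω := fun k => {ω |
    FedGen.empiricalRisk R c (fun i => S k i ω) (FedGen.toPredictor (h k ω))
      + FedGen.complexityTerm d K δ m' <
    FedGen.risk R c (FedGen.mixture (Dloc k) DA) (FedGen.toPredictor (h k ω))}
  have hbad : ∀ k, P.real (bad k) ≤ δ / K := fun k =>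
    ENNReal.toReal_le_of_le_ofReal (by positivity)
      ((hS k).measure_empiricalRisk_add_lt_risk_le hm' hR hc hH hd.le hdm' hK hδ0 hδ1
        (hhH k) (hhm k))
  have hunion : P.real (⋃ k, bad k) ≤ δ := by
    calc P.real (⋃ k, bad k) ≤ ∑ k, P.real (bad k) := measureReal_iUnion_fintype_le _
      _ ≤ ∑ _k : Fin K, δ / K := Finset.sum_le_sum fun k _ => hbad k
      _ = δ := by simp; field_simp
  set good : Set Ω := _
  change 1 - δ ≤ P.real good
  -- Covering the space and subadditivity avoid any measurability of `good`.
  have hcover : P.real Set.univ ≤ P.real good + P.real (⋃ k, bad k) := by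
    refine (measureReal_mono fun ω _ => ?_).trans (measureReal_union_le _ _)
    by_contra hω
    simp only [Set.mem_union, Set.mem_iUnion, not_or, not_exists, bad, Set.mem_ofPred_eq,
      not_lt] at hω
    refine hω.1 ((hadapt (fun k => h k ω) fun k => hhH k ω).trans ?_)
    have hsum := Finset.sum_le_sum fun k (_ : k ∈ Finset.univ) => hω.2 k
    have havg := mul_le_mul_of_nonneg_left hsum (one_div_pos.2 hK').le
    rw [Finset.sum_add_distrib, mul_add, Finset.sum_const, Finset.card_univ, Fintype.card_fin,
      nsmul_eq_mul, ← mul_assoc (1 / (K : ℝ)), one_div_mul_cancel hK'.ne', one_mul] at havg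
    linarith
  rw [probReal_univ] at hcover
  linarith
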